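/- Let $\mathcal C$ be a $\mathbf C$-linear abelian symmetric rigid tensor category (with $\mathbf C$-bilinear tensor product) such that $\operatorname{End}(\mathbf 1)=\mathbf C$, every object of $\mathcal C$ has finite length, and $\mathcal C$ has, up to isomorphism, only finitely many irreducible (i.e. simple) objects. For an object $V$ of $\mathcal C$ with dual $V^*$, let the categorical dimension $\dim_c(V)\in\mathbf C=\operatorname{End}(\mathbf 1)$ be the composite $$\mathbf 1\longrightarrow V\otimes V^*\xrightarrow{\ \beta_{V,V^*}\ }V^*\otimes V\longrightarrow\mathbf 1,$$ where $\beta$ is the commutativity constraint and the outer arrows are the two structure morphisms of the duality between $V$ and $V^*$. Then $\dim_c(V)$ is an integer for every object $V$ of $\mathcal C$. -/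

import Mathlib

open CategoryTheory MonoidalCategory

universe v u

namespace SymCat

variable (C : Type u) [Category.{v} C]

section Finiteness

variable [Abelian C]

/-- Every object has finite length: its subobjects satisfy both the ascending and the descending
chain condition (for an abelian category this says that every object has a finite composition
series). -/
def FiniteLength : Prop :=
  ∀ X : C, IsNoetherianObject X ∧ IsArtinianObject X

/-- There are finitely many irreducible (that is, simple) objects up to isomorphism. -/
def FinitelyManySimples : Prop :=
  ∃ (n : ℕ) (S : Fin n → C),
    (∀ i, Simple (S i)) ∧ ∀ X : C, Simple X → ∃ i, Nonempty (X ≅ S i)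

end Finiteness

section Dimension

/-- `End(𝟙) = ℂ`: every endomorphism of the unit object is a unique complex multiple of the
identity. -/
def EndUnitIsComplex [Preadditive C] [Linear ℂ C] [MonoidalCategory C] : Prop :=
  Function.Bijective (algebraMap ℂ (End (𝟙_ C)))

variable {C}

/-- The categorical dimension of `V` as an endomorphism of the unit object, the composite
`𝟙 ⟶ V ⊗ V* ⟶ V* ⊗ V ⟶ 𝟙` whose middle arrow is the commutativity constraint. -/
def dimHom [MonoidalCategory C] [BraidedCategory C] [RightRigidCategory C] (V : C) :
    End (𝟙_ C) :=
  (η_ V Vᘁ ≫ (β_ V Vᘁ).hom ≫ ε_ V Vᘁ : 𝟙_ C ⟶ 𝟙_ C)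

/-- The categorical dimension of `V` as a complex number, through the identification
`ℂ ≃ End(𝟙)`, `c ↦ c • 𝟙`. -/
noncomputable def categoricalDim [Preadditive C] [Linear ℂ C] [MonoidalCategory C]
    [BraidedCategory C] [RightRigidCategory C] (hEnd : EndUnitIsComplex C) (V : C) : ℂ :=
  (RingEquiv.ofBijective (algebraMap ℂ (End (𝟙_ C))) hEnd).symm (dimHom V)

/-- The defining property of the categorical dimension. -/
theorem categoricalDim_smul_id [Preadditive C] [Linear ℂ C] [MonoidalCategory C]
    [BraidedCategory C] [RightRigidCategory C] (hEnd : EndUnitIsComplex C) (V : C) :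
    categoricalDim hEnd V • 𝟙 (𝟙_ C) = η_ V Vᘁ ≫ (β_ V Vᘁ).hom ≫ ε_ V Vᘁ :=
  (RingEquiv.ofBijective (algebraMap ℂ (End (𝟙_ C))) hEnd).apply_symm_apply (dimHom V)

end Dimension

end SymCat

/-!
The dimension is the trace of an identity morphism, and it behaves like a character of a
Grothendieck ring.

* The trace is cyclic and does not depend on the dual used to define it, and the trace on `T ⊗ V` is
  the trace on `T` of the partial trace over `V` (`trace_tensor`). So the dimension is
  multiplicative.
* Tensoring and dualising are exact in a rigid abelian category, which makes the dimension additive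
  on short exact sequences (`ShortExact.dimHom_add`).
* As objects have finite length and there are finitely many simple objects, the dimensions span a
  finitely generated subgroup of `ℂ` that is stable under multiplication by dimensions. So all
  dimensions are algebraic integers (`isIntegral_categoricalDim`).
* The symmetrizer and the antisymmetrizer of `V^{⊗n}` are idempotents, so their images, the
  symmetric and the exterior power of `V`, are objects. With `d` the dimension of `V`, the partial
  trace gives their dimensions `d + n - 1 choose n` and `d choose n`
  (`exists_categoricalDim_eq_prod`).

So the products `∏ j < n, (d² - j²) / (j + 1)²` of these binomial coefficients are algebraic
integers for every `n`. All their conjugates tend to zero as `n` grows, hence one of them is zero and `d` is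
plus or minus a natural number (`exists_int_of_isIntegral_prod`).
-/

namespace SymCat

/-! ### Algebraic integers with integral binomial coefficients -/

section Arithmetic
open Finset NumberField IntermediateField

/-- The quotient of the two products is `O(1 / n)`, because its factors are eventually at most
`j / (j + 1)`. -/
theorem exists_prod_add_sq_lt (H : ℝ) (hH : 0 ≤ H) :
    ∃ n : ℕ, ∏ j ∈ range n, (H + (j : ℝ) ^ 2) < ∏ j ∈ range n, ((j : ℝ) + 1) ^ 2 := by
  obtain ⟨J, hJ⟩ := exists_nat_ge (H + 1)
  have hJ0 : (0 : ℝ) < J := by linarith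
  have hpos : ∀ n : ℕ, 0 < ∏ j ∈ range n, ((j : ℝ) + 1) ^ 2 :=
    fun n => prod_pos fun j _ => by positivity
  set p : ℕ → ℝ := fun n => ∏ j ∈ range n, (H + (j : ℝ) ^ 2) with hp
  set q : ℕ → ℝ := fun n => ∏ j ∈ range n, ((j : ℝ) + 1) ^ 2 with hq
  have hp0 : ∀ n, 0 ≤ p n := fun n => prod_nonneg fun j _ => by positivity
  -- for `j ≥ J ≥ H` one has `H + j² ≤ j (j + 1)`, so `n * p n / q n` is nonincreasing from `J` on
  have key : ∀ k : ℕ, ((J + k : ℕ) : ℝ) * p (J + k) * q J ≤ J * p J * q (J + k) := by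
    intro k
    induction k with
    | zero => simp
    | succ k ih =>
      rw [← add_assoc]
      have h1 : p (J + k + 1) = p (J + k) * (H + ((J + k : ℕ) : ℝ) ^ 2) := prod_range_succ _ _
      have h2 : q (J + k + 1) = q (J + k) * (((J + k : ℕ) : ℝ) + 1) ^ 2 := prod_range_succ _ _
      rw [h1, h2]
      set m : ℝ := ((J + k : ℕ) : ℝ) with hm
      have hmJ : (J : ℝ) ≤ m := by simp [hm]
      have h3 : H + m ^ 2 ≤ m * (m + 1) := by nlinarith
      have h4 : ((J + k + 1 : ℕ) : ℝ) = m + 1 := by simp [hm]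
      rw [h4]
      have hqJ := (hpos J).le
      have hm0 : 0 ≤ m + 1 := by linarith
      calc (m + 1) * (p (J + k) * (H + m ^ 2)) * q J
          = (H + m ^ 2) * ((m + 1) * p (J + k) * q J) := by ring
        _ ≤ (m * (m + 1)) * ((m + 1) * p (J + k) * q J) := by
            refine mul_le_mul_of_nonneg_right h3 (mul_nonneg (mul_nonneg hm0 (hp0 _)) hqJ)
        _ = (m + 1) ^ 2 * (m * p (J + k) * q J) := by ring
        _ ≤ (m + 1) ^ 2 * (J * p J * q (J + k)) := by
            exact mul_le_mul_of_nonneg_left ih (by positivity)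
        _ = J * p J * (q (J + k) * (m + 1) ^ 2) := by ring
  obtain ⟨k, hk⟩ := exists_nat_gt (J * p J / q J)
  refine ⟨J + k, ?_⟩
  change p (J + k) < q (J + k)
  by_contra! hcon
  have h5 : J * p J < ((J + k : ℕ) : ℝ) * q J := by
    rw [div_lt_iff₀ (hpos J)] at hk
    push_cast
    nlinarith [hpos J, mul_pos hJ0 (hpos J)]
  have h6 := key k
  have h7 : J * p J * q (J + k) < ((J + k : ℕ) : ℝ) * q J * q (J + k) :=
    mul_lt_mul_of_pos_right h5 (hpos _)
  have h8 : ((J + k : ℕ) : ℝ) * q J * q (J + k) ≤ ((J + k : ℕ) : ℝ) * q J * p (J + k) :=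
    mul_le_mul_of_nonneg_left hcon (mul_nonneg (Nat.cast_nonneg _) (hpos J).le)
  linarith

/-- An algebraic integer `d` is a rational integer as soon as all the numbers
`z n = ∏ j < n, (d² - j²) / (j + 1)²`, the products of the binomial coefficients `d choose n` and
`d + n - 1 choose n`, are algebraic integers: every conjugate of `z n` tends to `0`, so some `z n`
vanishes. -/
theorem exists_int_of_isIntegral_prod (d : ℂ) (hd : IsIntegral ℤ d)
    (h : ∀ n : ℕ, IsIntegral ℤ (∏ j ∈ range n, (d ^ 2 - (j : ℂ) ^ 2) / ((j : ℂ) + 1) ^ 2)) :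
    ∃ m : ℤ, d = m := by
  have hdQ : IsIntegral ℚ d := hd.tower_top
  have : FiniteDimensional ℚ ℚ⟮d⟯ := adjoin.finiteDimensional hdQ
  have : NumberField ℚ⟮d⟯ := ⟨⟩
  set K := ℚ⟮d⟯
  set δ : K := AdjoinSimple.gen ℚ d
  have hδd : algebraMap K ℂ δ = d := AdjoinSimple.algebraMap_gen ℚ d
  let z : ℕ → K := fun n => ∏ j ∈ range n, (δ ^ 2 - (j : K) ^ 2) / ((j : K) + 1) ^ 2
  have hz : ∀ n, IsIntegral ℤ (z n) := by
    intro n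
    have h1 : algebraMap K ℂ (z n)
        = ∏ j ∈ range n, (d ^ 2 - (j : ℂ) ^ 2) / ((j : ℂ) + 1) ^ 2 := by
      have hδd' : (δ : ℂ) = d := hδd
      simp [z, hδd']
    rw [← isIntegral_algebraMap_iff (algebraMap K ℂ).injective, h1]
    exact h n
  obtain ⟨n, hn⟩ := exists_prod_add_sq_lt (house (δ ^ 2)) (house_nonneg _)
  -- a nonzero algebraic integer has house at least `1`, but the house of `z n` is less than `1`
  have hzn : z n = 0 := by
    by_contra hne
    have h1 := one_le_house_of_isIntegral (hz n) hne
    have h2 : ((∏ j ∈ range n, (j + 1) ^ 2 : ℕ) : K) * z n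
        = ∏ j ∈ range n, (δ ^ 2 - (j : K) ^ 2) := by
      push_cast
      rw [← prod_mul_distrib]
      refine prod_congr rfl fun j _ => ?_
      have : ((j : K) + 1) ≠ 0 := by exact_mod_cast Nat.succ_ne_zero j
      field_simp
    have h3 : ∀ k : ℕ, house (∏ j ∈ range k, (δ ^ 2 - (j : K) ^ 2))
        ≤ ∏ j ∈ range k, (house (δ ^ 2) + (j : ℝ) ^ 2) := by
      intro k
      induction k with
      | zero =>
        have := house_intCast (K := K) 1
        simp_all
      | succ k ih =>
        rw [prod_range_succ, prod_range_succ]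
        refine (house_mul_le _ _).trans (mul_le_mul ih ?_ (house_nonneg _) ?_)
        · have h4 : δ ^ 2 - (k : K) ^ 2 = δ ^ 2 + ((-(k : ℤ) ^ 2 : ℤ) : K) := by
            push_cast; ring
          rw [h4]
          refine (house_add_le _ _).trans ?_
          rw [house_intCast]
          simp
        · exact prod_nonneg fun j _ => add_nonneg (house_nonneg _) (by positivity)
    have h4 := h3 n
    rw [← h2, house_nat_mul] at h4
    push_cast at h4
    have h5 : (0 : ℝ) ≤ ∏ j ∈ range n, ((j : ℝ) + 1) ^ 2 := prod_nonneg fun j _ => by positivity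
    nlinarith
  obtain ⟨j, -, hj⟩ := prod_eq_zero_iff.mp hzn
  have hj' : ((j : K) + 1) ^ 2 ≠ 0 := pow_ne_zero _ (by exact_mod_cast Nat.succ_ne_zero j)
  have h6 : δ ^ 2 = (j : K) ^ 2 := by
    rw [div_eq_zero_iff] at hj
    exact sub_eq_zero.mp (hj.resolve_right hj')
  have h7 : d ^ 2 = (j : ℂ) ^ 2 := by
    rw [← hδd, ← map_pow, h6]; simp
  rcases sq_eq_sq_iff_eq_or_eq_neg.mp h7 with h8 | h8
  · exact ⟨j, by simp [h8]⟩
  · exact ⟨-j, by simp [h8]⟩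

end Arithmetic

/-! ### Traces in a symmetric monoidal category -/

section Trace
variable {C : Type u} [Category.{v} C] [MonoidalCategory C] [SymmetricCategory C]

/-- The evaluation of the pairing of `X` with its dual `Y`, with its factors exchanged by the
braiding. -/
def swapEval (X Y : C) [ExactPairing X Y] : X ⊗ Y ⟶ 𝟙_ C := (β_ X Y).hom ≫ ε_ X Y

/-- The categorical trace of an endomorphism of `X`, computed with the dual `Y` of `X`. It does not
depend on the choice of the dual, see `trace_eq_trace`. -/
def trace {X : C} (Y : C) [ExactPairing X Y] (f : X ⟶ X) : 𝟙_ C ⟶ 𝟙_ C :=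
  η_ X Y ≫ f ▷ Y ≫ swapEval X Y

/-- The trace of an endomorphism of `T ⊗ V` over the factor `V`, computed with the dual `V'` of
`V`. -/
def partialTrace {T V : C} (V' : C) [ExactPairing V V'] (f : T ⊗ V ⟶ T ⊗ V) : T ⟶ T :=
  (ρ_ T).inv ≫ T ◁ η_ V V' ≫ (α_ T V V').inv ≫ f ▷ V' ≫ (α_ T V V').hom ≫ T ◁ swapEval V V' ≫
    (ρ_ T).hom

theorem whiskerRight_swapEval {X Y : C} [HasRightDual X] [HasRightDual Y] (f : X ⟶ Y) :
    f ▷ Yᘁ ≫ swapEval Y Yᘁ = X ◁ fᘁ ≫ swapEval X Xᘁ := by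
  simp only [swapEval]
  rw [BraidedCategory.braiding_naturality_left_assoc, ← rightAdjointMate_comp_evaluation,
    BraidedCategory.braiding_naturality_right_assoc]

theorem trace_comp_comm {X Y : C} [HasRightDual X] [HasRightDual Y] (f : X ⟶ Y) (g : Y ⟶ X) :
    trace Xᘁ (f ≫ g) = trace Yᘁ (g ≫ f) := by
  simp only [trace, comp_whiskerRight, Category.assoc]
  rw [whiskerRight_swapEval f, ← whisker_exchange_assoc, ← coevaluation_comp_rightAdjointMate_assoc]

/-- Cyclicity of the trace, applied to the identity of `X` with two choices of the dual. -/
theorem trace_eq_trace {X : C} (Y Y' : C) [h : ExactPairing X Y] [h' : ExactPairing X Y']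
    (f : X ⟶ X) : trace Y f = trace Y' f := by
  have := @trace_comp_comm C _ _ _ X X ⟨Y⟩ ⟨Y'⟩ f (𝟙 X)
  simpa using this

/-- Moving the strand `V` across `T'` and then closing up `T` is the same as moving it across `T`
the other way: naturality of the braiding of `V` with `swapEval T T'`, and the symmetry. -/
theorem braiding_left_swapEval (V T T' : C) [ExactPairing T T'] :
    T ◁ (β_ V T').hom ≫ (α_ T T' V).inv ≫ swapEval T T' ▷ V =
      (α_ T V T').inv ≫ (β_ T V).hom ▷ T' ≫ (α_ V T T').hom ≫ V ◁ swapEval T T' ≫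
        (ρ_ V).hom ≫ (λ_ V).inv := by
  have h := BraidedCategory.braiding_naturality_right V (swapEval T T')
  rw [BraidedCategory.braiding_tensor_right_hom] at h
  rw [braiding_tensorUnit_right] at h
  rw [h]
  simp [← comp_whiskerRight_assoc]

/-- For the dual `V' ⊗ T'` of `T ⊗ V`, the exchanged evaluation closes up `V` first and then `T`.
This needs the braiding to be symmetric. -/
theorem swapEval_tensor (T T' V V' : C) [ExactPairing T T'] [ExactPairing V V'] :
    swapEval (T ⊗ V) (V' ⊗ T') =
      𝟙 _ ⊗≫ T ◁ (swapEval V V' ▷ T') ⊗≫ swapEval T T' := by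
  have h := braiding_left_swapEval V T T'
  have hn := BraidedCategory.braiding_naturality_right T (ε_ V V')
  rw [BraidedCategory.braiding_tensor_right_hom, braiding_tensorUnit_right] at hn
  calc
    _ = 𝟙 _ ⊗≫ T ◁ ((β_ V V').hom ▷ T') ⊗≫ (T ◁ V' ◁ (β_ V T').hom ⊗≫ (β_ T V').hom ▷ (T' ⊗ V))
          ⊗≫ V' ◁ ((β_ T T').hom ▷ V) ⊗≫ V' ◁ (ε_ T T' ▷ V) ⊗≫ ε_ V V' := by
      rw [swapEval, ExactPairing.tensor_evaluation,
        BraidedCategory.braiding_tensor_left_hom, BraidedCategory.braiding_tensor_right_hom,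
        BraidedCategory.braiding_tensor_right_hom]
      monoidal
    _ = 𝟙 _ ⊗≫ T ◁ ((β_ V V').hom ▷ T') ⊗≫ ((T ⊗ V') ◁ (β_ V T').hom ≫ (β_ T V').hom ▷ (T' ⊗ V))
          ⊗≫ V' ◁ ((β_ T T').hom ▷ V) ⊗≫ V' ◁ (ε_ T T' ▷ V) ⊗≫ ε_ V V' := by
      monoidal
    _ = 𝟙 _ ⊗≫ T ◁ ((β_ V V').hom ▷ T') ⊗≫ (β_ T V').hom ▷ (V ⊗ T') ⊗≫
          V' ◁ (T ◁ (β_ V T').hom ≫ (α_ T T' V).inv ≫ swapEval T T' ▷ V) ⊗≫ ε_ V V' := by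
      rw [whisker_exchange, swapEval]
      monoidal
    _ = 𝟙 _ ⊗≫ T ◁ ((β_ V V').hom ▷ T') ⊗≫ (((α_ T V' V).inv ≫ (β_ T V').hom ▷ V ≫
          (α_ V' T V).hom ≫ V' ◁ (β_ T V).hom ≫ (α_ V' V T).inv)) ▷ T' ⊗≫
          ((V' ⊗ V) ◁ swapEval T T' ≫ ε_ V V' ▷ (𝟙_ C)) ⊗≫ 𝟙 _ := by
      rw [h]
      monoidal
    _ = 𝟙 _ ⊗≫ T ◁ ((β_ V V').hom ▷ T') ⊗≫ (((α_ T V' V).inv ≫ (β_ T V').hom ▷ V ≫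
          (α_ V' T V).hom ≫ V' ◁ (β_ T V).hom ≫ (α_ V' V T).inv) ≫ ε_ V V' ▷ T) ▷ T' ⊗≫
          swapEval T T' ⊗≫ 𝟙 _ := by
      rw [whisker_exchange]
      monoidal
    _ = _ := by
      simp only [Category.assoc] at hn ⊢
      rw [← hn]
      simp only [swapEval]
      monoidal

theorem trace_tensor {T V : C} (T' V' : C) [ExactPairing T T'] [ExactPairing V V']
    (f : T ⊗ V ⟶ T ⊗ V) : trace (V' ⊗ T') f = trace T' (partialTrace V' f) := by
  rw [trace, trace, swapEval_tensor, ExactPairing.tensor_coevaluation, partialTrace]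
  monoidal

theorem partialTrace_whiskerRight {T V : C} (V' : C) [ExactPairing V V'] (a b : T ⟶ T)
    (f : T ⊗ V ⟶ T ⊗ V) :
    partialTrace V' (a ▷ V ≫ f ≫ b ▷ V) = a ≫ partialTrace V' f ≫ b := by
  simp only [partialTrace]
  calc
    _ = 𝟙 _ ⊗≫ (T ◁ η_ V V' ≫ a ▷ (V ⊗ V')) ⊗≫ f ▷ V' ⊗≫ (b ▷ (V ⊗ V') ≫ T ◁ swapEval V V')
        ⊗≫ 𝟙 _ := by monoidal
    _ = _ := by
      rw [whisker_exchange a, ← whisker_exchange b]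
      monoidal

theorem partialTrace_id {T V : C} (V' : C) [ExactPairing V V'] :
    partialTrace V' (𝟙 (T ⊗ V)) = (ρ_ T).inv ≫ T ◁ trace V' (𝟙 V) ≫ (ρ_ T).hom := by
  simp [partialTrace, trace]

/-- The braiding of the last two factors of `(T ⊗ V) ⊗ V`. -/
def lastSwap (T V : C) : (T ⊗ V) ⊗ V ⟶ (T ⊗ V) ⊗ V :=
  (α_ T V V).hom ≫ T ◁ (β_ V V).hom ≫ (α_ T V V).inv

/-- The crossing followed by the braiding in `swapEval V V'` is the braiding of `V` with `V ⊗ V'`,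
which slides along the coevaluation; what remains is a triangle identity. -/
theorem partialTrace_lastSwap (T V V' : C) [ExactPairing V V'] :
    partialTrace V' (lastSwap T V) = 𝟙 (T ⊗ V) := by
  have h := BraidedCategory.braiding_naturality_right V (η_ V V')
  rw [BraidedCategory.braiding_tensor_right_hom, braiding_tensorUnit_right] at h
  simp only [partialTrace, lastSwap]
  calc
    _ = 𝟙 _ ⊗≫ T ◁ (V ◁ η_ V V' ≫ (α_ V V V').inv ≫ (β_ V V).hom ▷ V' ≫ (α_ V V V').hom ≫
        V ◁ (β_ V V').hom ≫ (α_ V V' V).inv) ⊗≫ T ◁ V ◁ ε_ V V' ⊗≫ 𝟙 _ := by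
      rw [swapEval]; monoidal
    _ = 𝟙 _ ⊗≫ T ◁ (η_ V V' ▷ V ⊗≫ V ◁ ε_ V V') ⊗≫ 𝟙 _ := by
      simp only [Category.assoc] at h
      rw [h]; monoidal
    _ = _ := by
      rw [ExactPairing.evaluation_coevaluation'']; monoidal

theorem lastSwap_sq (T V : C) : lastSwap T V ≫ lastSwap T V = 𝟙 _ := by
  simp [lastSwap, ← MonoidalCategory.whiskerLeft_comp_assoc]

theorem whiskerRight_lastSwap {T V : C} (f : T ⟶ T) :
    f ▷ V ▷ V ≫ lastSwap T V = lastSwap T V ≫ f ▷ V ▷ V := by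
  calc
    _ = 𝟙 _ ⊗≫ (f ▷ (V ⊗ V) ≫ T ◁ (β_ V V).hom) ⊗≫ 𝟙 _ := by rw [lastSwap]; monoidal
    _ = _ := by rw [← whisker_exchange, lastSwap]; monoidal

theorem lastSwap_braid (T V : C) :
    lastSwap T V ▷ V ≫ lastSwap (T ⊗ V) V ≫ lastSwap T V ▷ V =
      lastSwap (T ⊗ V) V ≫ lastSwap T V ▷ V ≫ lastSwap (T ⊗ V) V := by
  have h := BraidedCategory.yang_baxter V V V
  calc
    _ = 𝟙 _ ⊗≫ T ◁ ((α_ V V V).inv ≫ (β_ V V).hom ▷ V ≫ (α_ V V V).hom ≫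
      V ◁ (β_ V V).hom ≫ (α_ V V V).inv ≫ (β_ V V).hom ▷ V ≫ (α_ V V V).hom) ⊗≫ 𝟙 _ := by
      simp only [lastSwap]; monoidal
    _ = _ := by rw [h]; simp only [lastSwap]; monoidal

theorem trace_unit : trace (𝟙_ C) (𝟙 (𝟙_ C)) = 𝟙 (𝟙_ C) := by
  simp [trace, swapEval, ExactPairing.coevaluation, ExactPairing.evaluation,
    ExactPairing.coevaluation', ExactPairing.evaluation']
  monoidal

end Trace

/-! ### Exactness of duals and additivity of the dimension -/

open Limits
section Duality
variable {C : Type u} [Category.{v} C] [MonoidalCategory C] [RigidCategory C]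

/-- Under the adjunction between `- ⊗ B` and `- ⊗ B*`, the dual of `i` corresponds to
precomposition with `i`. -/
theorem whiskerLeft_comp_tensorRightHomEquiv_symm {P X A B : C} (i : A ⟶ B)
    (x : P ⟶ X ⊗ Bᘁ) :
    P ◁ i ≫ (tensorRightHomEquiv P B Bᘁ X).symm x =
      (tensorRightHomEquiv P A Aᘁ X).symm (x ≫ X ◁ iᘁ) := by
  simp only [tensorRightHomEquiv, Equiv.coe_fn_symm_mk, comp_whiskerRight, Category.assoc]
  rw [whisker_exchange_assoc]
  calc
    _ = x ▷ A ⊗≫ X ◁ (Bᘁ ◁ i ≫ ε_ B Bᘁ) ⊗≫ 𝟙 _ := by monoidal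
    _ = _ := by rw [← rightAdjointMate_comp_evaluation]; monoidal

end Duality

section Exactness
variable {C : Type u} [Category.{v} C] [Abelian C] [MonoidalCategory C] [MonoidalPreadditive C]
  [RigidCategory C]

instance mono_whiskerRight {A B : C} (i : A ⟶ B) [Mono i] (Z : C) : Mono (i ▷ Z) :=
  have := Functor.preservesMonomorphisms_of_adjunction (tensorRightAdjunction (ᘁZ : C) Z)
  inferInstanceAs (Mono ((tensorRight Z).map i))

theorem ShortExact.tensorLeft {S : ShortComplex C} (hS : S.ShortExact) (P : C) :
    (S.map (tensorLeft P)).ShortExact := by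
  have := (tensorLeftAdjunction P Pᘁ).rightAdjoint_preservesLimits
  have := (tensorLeftAdjunction (ᘁP : C) P).leftAdjoint_preservesColimits
  have : PreservesFiniteLimits (MonoidalCategory.tensorLeft P) :=
    PreservesLimits.preservesFiniteLimits _
  have : PreservesFiniteColimits (MonoidalCategory.tensorLeft P) :=
    PreservesColimits.preservesFiniteColimits _
  exact hS.map_of_exact _

theorem tensorRightHomEquiv_symm_zero (P X A : C) :
    (tensorRightHomEquiv P A Aᘁ X).symm 0 = 0 := by
  simp [tensorRightHomEquiv]

/-- Exactness of `X ⊗ S.X₃* ⟶ X ⊗ S.X₂* ⟶ X ⊗ S.X₁*` in the middle: by adjunction, a morphism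
`P ⟶ X ⊗ S.X₂*` is a morphism `P ⊗ S.X₂ ⟶ X`, and it factors through `P ⊗ S.X₃` once it vanishes on
`P ⊗ S.X₁`. -/
theorem ShortExact.exists_lift_whiskerLeft_rightAdjointMate {S : ShortComplex C}
    (hS : S.ShortExact) {P X : C} (x : P ⟶ X ⊗ S.X₂ᘁ) (hx : x ≫ X ◁ S.fᘁ = 0) :
    ∃ z : P ⟶ X ⊗ S.X₃ᘁ, z ≫ X ◁ S.gᘁ = x := by
  have hP := ShortExact.tensorLeft hS P
  have := hP.epi_g
  let h := (tensorRightHomEquiv P S.X₂ S.X₂ᘁ X).symm x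
  have hh : P ◁ S.f ≫ h = 0 := by
    rw [whiskerLeft_comp_tensorRightHomEquiv_symm, hx, tensorRightHomEquiv_symm_zero]
  let k : P ⊗ S.X₃ ⟶ X := hP.exact.desc h hh
  have hk : P ◁ S.g ≫ k = h := hP.exact.g_desc h hh
  refine ⟨tensorRightHomEquiv P S.X₃ S.X₃ᘁ X k, ?_⟩
  apply (tensorRightHomEquiv P S.X₂ S.X₂ᘁ X).symm.injective
  rw [← whiskerLeft_comp_tensorRightHomEquiv_symm, Equiv.symm_apply_apply, hk]

theorem mono_whiskerLeft_rightAdjointMate {A B : C} (p : A ⟶ B) [Epi p] (X : C) :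
    Mono (X ◁ rightAdjointMate p) := by
  refine Preadditive.mono_of_cancel_zero _ fun {P} z hz => ?_
  have := Functor.preservesEpimorphisms_of_adjunction (tensorLeftAdjunction (ᘁP : C) P)
  have : Epi (P ◁ p) := inferInstanceAs (Epi ((tensorLeft P).map p))
  apply (tensorRightHomEquiv P B Bᘁ X).symm.injective
  rw [tensorRightHomEquiv_symm_zero, ← cancel_epi (P ◁ p),
    whiskerLeft_comp_tensorRightHomEquiv_symm, hz, tensorRightHomEquiv_symm_zero, comp_zero]

/-- A morphism `g` out of `A*` is determined by `η ≫ A ◁ g : 𝟙 ⟶ A ⊗ Z`, and `i ▷ Z` is a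
monomorphism. -/
theorem epi_rightAdjointMate {A B : C} (i : A ⟶ B) [Mono i] : Epi (rightAdjointMate i) := by
  refine Preadditive.epi_of_cancel_zero _ fun {Z} g hg => ?_
  have h0 : η_ A Aᘁ ≫ A ◁ g = 0 := by
    rw [← cancel_mono (i ▷ Z), Category.assoc, whisker_exchange,
      ← coevaluation_comp_rightAdjointMate_assoc, ← MonoidalCategory.whiskerLeft_comp, hg]
    simp
  have h1 : tensorLeftHomEquiv (𝟙_ C) A Aᘁ Z ((ρ_ _).hom ≫ g) = 0 := by
    calc
      _ = η_ A Aᘁ ≫ A ◁ g := by simp only [tensorLeftHomEquiv, Equiv.coe_fn_mk]; monoidal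
      _ = 0 := h0
  rw [← cancel_epi (ρ_ _).hom, comp_zero]
  apply (tensorLeftHomEquiv (𝟙_ C) A Aᘁ Z).injective
  rw [h1]
  simp [tensorLeftHomEquiv]

theorem epi_whiskerLeft_rightAdjointMate {A B : C} (i : A ⟶ B) [Mono i] (X : C) :
    Epi (X ◁ rightAdjointMate i) := by
  have := epi_rightAdjointMate i
  have := Functor.preservesEpimorphisms_of_adjunction (tensorLeftAdjunction (ᘁX : C) X)
  exact inferInstanceAs (Epi ((tensorLeft X).map (rightAdjointMate i)))

end Exactness

section Dimension
variable {C : Type u} [Category.{v} C] [MonoidalCategory C] [SymmetricCategory C]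
  [RigidCategory C]

theorem dimHom_eq (V : C) : dimHom V = η_ V Vᘁ ≫ swapEval V Vᘁ := rfl

theorem dimHom_eq_trace (V : C) : dimHom V = trace Vᘁ (𝟙 V) := by
  simp [dimHom_eq, trace]

theorem dimHom_eq_of_iso {X Y : C} (e : X ≅ Y) : dimHom X = dimHom Y := by
  rw [dimHom_eq_trace, dimHom_eq_trace, ← e.hom_inv_id, trace_comp_comm, e.inv_hom_id]

end Dimension

section Additivity
variable {C : Type u} [Category.{v} C] [Abelian C] [MonoidalCategory C] [MonoidalPreadditive C]
  [SymmetricCategory C] [RigidCategory C]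

/-- Additivity of the dimension on a short exact sequence `A ⟶ B ⟶ Q`. After passing to an
epimorphism onto `𝟙`, the coevaluation of `B` is the sum of a part `y` in `A ⊗ B*` and a part `z` in
`B ⊗ Q*`; the image of `y` in `A ⊗ A*` is the coevaluation of `A`, and the image of `z` in `Q ⊗ Q*`
is that of `Q`. The evaluation of `B` on these parts is that of `A` and of `Q`. -/
theorem ShortExact.dimHom_add {S : ShortComplex C} (hS : S.ShortExact) :
    dimHom S.X₂ = dimHom S.X₁ + dimHom S.X₃ := by
  have := hS.mono_f
  have := hS.epi_g
  have := epi_whiskerLeft_rightAdjointMate S.f S.X₁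
  have := mono_whiskerLeft_rightAdjointMate S.g S.X₃
  obtain ⟨P, π, hπ, y, hy⟩ := surjective_up_to_refinements_of_epi (S.X₁ ◁ S.fᘁ) (η_ S.X₁ S.X₁ᘁ)
  obtain ⟨z, hz⟩ := ShortExact.exists_lift_whiskerLeft_rightAdjointMate hS
    (π ≫ η_ S.X₂ S.X₂ᘁ - y ≫ S.f ▷ S.X₂ᘁ) (by
      rw [Preadditive.sub_comp, Category.assoc, Category.assoc, coevaluation_comp_rightAdjointMate,
        ← whisker_exchange, ← reassoc_of% hy, sub_self])
  have hz' : z ≫ S.g ▷ S.X₃ᘁ = π ≫ η_ S.X₃ S.X₃ᘁ := by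
    rw [← cancel_mono (S.X₃ ◁ S.gᘁ), Category.assoc, Category.assoc,
      coevaluation_comp_rightAdjointMate, ← whisker_exchange, reassoc_of% hz,
      Preadditive.sub_comp, Category.assoc, Category.assoc, ← comp_whiskerRight, S.zero]
    simp
  have h : π ≫ η_ S.X₂ S.X₂ᘁ = y ≫ S.f ▷ S.X₂ᘁ + z ≫ S.X₂ ◁ S.gᘁ := by rw [hz]; abel
  have hmain : π ≫ (η_ S.X₂ S.X₂ᘁ ≫ swapEval S.X₂ S.X₂ᘁ) =
      π ≫ (η_ S.X₁ S.X₁ᘁ ≫ swapEval S.X₁ S.X₁ᘁ + η_ S.X₃ S.X₃ᘁ ≫ swapEval S.X₃ S.X₃ᘁ) := by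
    rw [reassoc_of% h, Preadditive.add_comp, Category.assoc, Category.assoc,
      whiskerRight_swapEval, ← whiskerRight_swapEval S.g, ← reassoc_of% hy, reassoc_of% hz',
      Preadditive.comp_add]
  exact (cancel_epi π).mp hmain

/-- If the dimensions of the simple objects lie in an additive subgroup, then so do all dimensions.
A maximal subobject `U` of `X` with dimension in `M` is `X`: otherwise `X / U` has a simple
subobject, whose preimage in `X` is a larger one. -/
theorem dimHom_mem_of_simple (M : AddSubgroup (End (𝟙_ C))) (hL : FiniteLength C)
    (hM : ∀ X : C, Simple X → dimHom X ∈ M) (X : C) : dimHom X ∈ M := by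
  have := (hL X).1
  have hzero : ∀ Z : C, IsZero Z → dimHom Z = 0 := fun Z hZ => by
    have := (hZ.eq_of_src (𝟙 Z) 0)
    rw [dimHom_eq_trace, this]
    simp [trace]
  have hmono : ∀ {A B : C} (i : A ⟶ B) [Mono i], dimHom B = dimHom A + dimHom (cokernel i) :=
    fun i _ => ShortExact.dimHom_add (S := ShortComplex.mk i (cokernel.π i) (by simp))
      { exact := ShortComplex.exact_cokernel i }
  have hepi : ∀ {A B : C} (p : A ⟶ B) [Epi p], dimHom A = dimHom (kernel p) + dimHom B :=
    fun p _ => ShortExact.dimHom_add (S := ShortComplex.mk (kernel.ι p) p (by simp))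
      { exact := ShortComplex.exact_kernel p }
  obtain ⟨U, hU, hmax⟩ := wellFounded_gt.has_min {U : Subobject X | dimHom (U : C) ∈ M}
    ⟨⊥, by
      have h0 := hzero _ ((isZero_zero C).of_iso (Subobject.botCoeIsoZero (B := X)))
      rw [Set.mem_ofPred_eq, h0]
      exact M.zero_mem⟩
  by_cases hQ : IsZero (cokernel U.arrow)
  · rw [hmono U.arrow, hzero _ hQ, add_zero]
    exact hU
  exfalso
  have := (hL (cokernel U.arrow)).2
  let s := simpleSubobjectArrow hQ
  -- the preimage of the simple subobject is the kernel of `q`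
  let q : X ⟶ cokernel s := cokernel.π U.arrow ≫ cokernel.π s
  refine hmax (Subobject.mk (kernel.ι q)) ?_ ?_
  · rw [Set.mem_ofPred_eq]
    have h1 := hmono U.arrow
    have h2 := hmono s
    have h3 := hepi q
    have h4 : dimHom (kernel q) = dimHom (U : C) + dimHom (simpleSubobject hQ) := by
      rw [h1, h2, ← add_assoc] at h3
      exact (add_right_cancel h3).symm
    rw [dimHom_eq_of_iso (Subobject.underlyingIso (kernel.ι q)), h4]
    exact M.add_mem hU (hM _ inferInstance)
  · refine lt_of_le_of_ne (Subobject.le_mk_of_comm (kernel.lift q U.arrow (by simp [q]))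
      (by simp)) fun hUq => ?_
    have h0 : kernel.ι q ≫ cokernel.π U.arrow = 0 := by
      have h1 : kernel.ι q = Subobject.ofMkLE _ U hUq.ge ≫ U.arrow := by simp
      rw [h1, Category.assoc, cokernel.condition, comp_zero]
    -- `cokernel.π U.arrow` factors through `q`, so `cokernel.π s` is a split monomorphism, though
    -- it kills the simple object
    have h2 : cokernel.π U.arrow ≫ cokernel.π s ≫
        (Abelian.epiDesc q (cokernel.π U.arrow) h0) = cokernel.π U.arrow := by
      rw [← Category.assoc]
      exact Abelian.comp_epiDesc q _ h0
    have h3 : s = 0 := by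
      have h4 : cokernel.π s ≫ (Abelian.epiDesc q (cokernel.π U.arrow) h0) = 𝟙 _ := by
        rw [← cancel_epi (cokernel.π U.arrow), h2, Category.comp_id]
      rw [← Category.comp_id s, ← h4, cokernel.condition_assoc, zero_comp]
    refine id_nonzero (simpleSubobject hQ) ?_
    rw [← cancel_mono s, h3, comp_zero, zero_comp]
end Additivity

/-! ### Symmetrizers -/

section Algebra
variable {E : Type*} [Ring E] [Algebra ℂ E]

/-- One step of the recursive construction of symmetrizers. Here `s` and `t` are consecutive simple
transpositions, and `a`, `b`, `c` are the symmetrizers on `n - 1`, `n` and `n + 1` letters. -/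
theorem symmetrizer_step_mul {a b c s t : E} {n : ℂ} (hn : n ≠ 0) (hn1 : n + 1 ≠ 0)
    (hb : n • b = a + (n - 1) • (a * s * a)) (hc : (n + 1) • c = b + n • (b * t * b))
    (ha : a * a = a) (hbb : b * b = b) (hbs : b * s = b) (hta : t * a = a * t)
    (htt : t * t = 1) (hst : s * t * s = t * s * t) : c * t = c ∧ c * c = c := by
  have hba : b * a = b := by
    apply smul_right_injective E hn
    change n • (b * a) = n • b
    rw [← smul_mul_assoc, hb, add_mul, ha, smul_mul_assoc, mul_assoc, ha]
  have hcb : c * b = c := by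
    apply smul_right_injective E hn1
    change (n + 1) • (c * b) = (n + 1) • c
    rw [← smul_mul_assoc, hc, add_mul, hbb, smul_mul_assoc, mul_assoc, hbb]
  have h1 : n • (b * t * b) = b * t + (n - 1) • (b * t * s * a) := by
    rw [← mul_smul_comm, hb, mul_add, mul_smul_comm]
    have h2 : b * t * a = b * t := by rw [mul_assoc, hta, ← mul_assoc, hba]
    rw [h2, ← mul_assoc, ← mul_assoc, h2]
  have h3 : b * t * s * a * t = b * t * s * a := by
    calc b * t * s * a * t = b * (t * s * t) * a := by simp only [mul_assoc, hta]
      _ = b * s * t * s * a := by rw [← hst]; simp only [mul_assoc]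
      _ = b * t * s * a := by rw [hbs]
  have hct : c * t = c := by
    apply smul_right_injective E hn1
    change (n + 1) • (c * t) = (n + 1) • c
    rw [← smul_mul_assoc, hc, h1, add_mul, add_mul, smul_mul_assoc, h3, mul_assoc b, htt, mul_one]
    abel
  refine ⟨hct, ?_⟩
  apply smul_right_injective E hn1
  change (n + 1) • (c * c) = (n + 1) • c
  have h4 : (n + 1) • (c * c) = c * (b + n • (b * t * b)) := by rw [← hc, mul_smul_comm]
  rw [h4, mul_add, mul_smul_comm, ← mul_assoc, ← mul_assoc, hcb, hct, hcb, add_smul, one_smul,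
    add_comm]

end Algebra

section PartialTrace
variable {C : Type u} [Category.{v} C] [Preadditive C] [MonoidalCategory C]
  [SymmetricCategory C] [MonoidalPreadditive C] {T V : C} (V' : C) [ExactPairing V V']

theorem partialTrace_add (f g : T ⊗ V ⟶ T ⊗ V) :
    partialTrace V' (f + g) = partialTrace V' f + partialTrace V' g := by
  simp [partialTrace]

variable [Linear ℂ C] [MonoidalLinear ℂ C]

theorem partialTrace_smul (r : ℂ) (f : T ⊗ V ⟶ T ⊗ V) :
    partialTrace V' (r • f) = r • partialTrace V' f := by
  simp [partialTrace]

theorem trace_smul (r : ℂ) (f : V ⟶ V) : trace V' (r • f) = r • trace V' f := by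
  simp [trace]

theorem partialTrace_id_eq_smul {d : ℂ} (hd : trace V' (𝟙 V) = d • 𝟙 (𝟙_ C)) :
    partialTrace V' (𝟙 (T ⊗ V)) = d • 𝟙 T := by
  rw [partialTrace_id, hd]
  simp

end PartialTrace

section Symmetrizer
variable {C : Type u} [Category.{v} C] [Preadditive C] [Linear ℂ C] [MonoidalCategory C]
  [SymmetricCategory C]

/-- `a` and `b` play the role of the symmetrizers on `V^{⊗(n + 1)} = T ⊗ V` and on
`V^{⊗(n + 2)} = (T ⊗ V) ⊗ V`, for the action of the symmetric group twisted by the sign character if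
`e = -1`. Keeping the object `T` arbitrary avoids recursion on objects; only the idempotency, the
recursion formula and the invariance of `b` under the last transposition are recorded, as they are
all that the next step needs. -/
structure IsSymmetrizerPair (e : ℂ) (n : ℕ) {T V : C} (a : T ⊗ V ⟶ T ⊗ V)
    (b : (T ⊗ V) ⊗ V ⟶ (T ⊗ V) ⊗ V) : Prop where
  left_idem : a ≫ a = a
  right_idem : b ≫ b = b
  smul_right : ((n : ℂ) + 2) • b =
    a ▷ V + ((n : ℂ) + 1) • (a ▷ V ≫ (e • lastSwap T V) ≫ a ▷ V)
  swap_right : (e • lastSwap T V) ≫ b = b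

theorem natCast_add_two_ne_zero (n : ℕ) : (n : ℂ) + 2 ≠ 0 := by
  exact_mod_cast (Nat.succ_ne_zero (n + 1))

theorem smul_lastSwap_sq {e : ℂ} (he : e * e = 1) (T V : C) :
    (e • lastSwap T V) ≫ (e • lastSwap T V) = 𝟙 _ := by
  rw [Linear.smul_comp, Linear.comp_smul, lastSwap_sq, smul_smul, he, one_smul]

theorem exists_isSymmetrizerPair_zero {e : ℂ} (he : e * e = 1) (T V : C) :
    ∃ b, IsSymmetrizerPair e 0 (𝟙 (T ⊗ V)) b := by
  have ht := smul_lastSwap_sq he T V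
  set t := e • lastSwap T V
  have h3 : t ≫ ((2 : ℂ)⁻¹ • (𝟙 ((T ⊗ V) ⊗ V) + t)) = (2 : ℂ)⁻¹ • (𝟙 ((T ⊗ V) ⊗ V) + t) := by
    rw [Linear.comp_smul, Preadditive.comp_add, ht, Category.comp_id, add_comm]
  refine ⟨(2 : ℂ)⁻¹ • (𝟙 _ + t), Category.comp_id _, ?_, by simp [t], h3⟩
  nth_rw 1 [Linear.smul_comp]
  rw [Preadditive.add_comp, h3, Category.id_comp, ← two_smul ℂ, inv_smul_smul₀ two_ne_zero]

variable [MonoidalPreadditive C] [MonoidalLinear ℂ C] {e : ℂ} {n : ℕ} {T V : C}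
  {a : T ⊗ V ⟶ T ⊗ V} {b : (T ⊗ V) ⊗ V ⟶ (T ⊗ V) ⊗ V}

theorem IsSymmetrizerPair.exists_succ (he : e * e = 1) (h : IsSymmetrizerPair e n a b) :
    ∃ c, IsSymmetrizerPair e (n + 1) b c := by
  have hn : ((n + 1 : ℕ) : ℂ) = (n : ℂ) + 1 := by push_cast; ring
  have hn2 := natCast_add_two_ne_zero (n + 1)
  refine ⟨(((n + 1 : ℕ) : ℂ) + 2)⁻¹ • (b ▷ V + (((n + 1 : ℕ) : ℂ) + 1) •
    (b ▷ V ≫ (e • lastSwap (T ⊗ V) V) ≫ b ▷ V)), ?_⟩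
  have hc := smul_inv_smul₀ hn2 (b ▷ V + (((n + 1 : ℕ) : ℂ) + 1) •
    (b ▷ V ≫ (e • lastSwap (T ⊗ V) V) ≫ b ▷ V))
  set c := (((n + 1 : ℕ) : ℂ) + 2)⁻¹ • (b ▷ V + (((n + 1 : ℕ) : ℂ) + 1) •
    (b ▷ V ≫ (e • lastSwap (T ⊗ V) V) ≫ b ▷ V))
  have key := symmetrizer_step_mul (E := End (((T ⊗ V) ⊗ V) ⊗ V))
    (a := a ▷ V ▷ V) (b := b ▷ V) (c := c) (s := (e • lastSwap T V) ▷ V)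
    (t := e • lastSwap (T ⊗ V) V) (n := (n : ℂ) + 2)
    (natCast_add_two_ne_zero n) ?_ ?_ ?_ ?_ ?_ ?_ ?_ ?_ ?_
  · exact ⟨h.right_idem, key.2, hc, key.1⟩
  · rw [hn] at hn2
    convert hn2 using 1
    ring
  · have hb := congrArg (· ▷ V) h.smul_right
    simp only [MonoidalLinear.smul_whiskerRight, MonoidalPreadditive.add_whiskerRight,
      comp_whiskerRight] at hb
    have h1 : (n : ℂ) + 2 - 1 = n + 1 := by ring
    rw [h1]
    simp only [End.mul_def, MonoidalLinear.smul_whiskerRight]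
    exact hb
  · rw [hn] at hc
    have h1 : (n : ℂ) + 1 + 2 = n + 2 + 1 := by ring
    have h2 : (n : ℂ) + 1 + 1 = n + 2 := by ring
    rw [h1, h2] at hc
    exact hc
  · change a ▷ V ▷ V ≫ a ▷ V ▷ V = _
    rw [← comp_whiskerRight, ← comp_whiskerRight, h.left_idem]
  · change b ▷ V ≫ b ▷ V = _
    rw [← comp_whiskerRight, h.right_idem]
  · change (e • lastSwap T V) ▷ V ≫ b ▷ V = _
    rw [← comp_whiskerRight, h.swap_right]
  · change a ▷ V ▷ V ≫ (e • lastSwap (T ⊗ V) V) = (e • lastSwap (T ⊗ V) V) ≫ a ▷ V ▷ V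
    rw [Linear.comp_smul, Linear.smul_comp, whiskerRight_lastSwap]
  · exact smul_lastSwap_sq he _ _
  · change (e • lastSwap T V) ▷ V ≫ (e • lastSwap (T ⊗ V) V) ≫ (e • lastSwap T V) ▷ V =
      (e • lastSwap (T ⊗ V) V) ≫ (e • lastSwap T V) ▷ V ≫ (e • lastSwap (T ⊗ V) V)
    simp only [MonoidalLinear.smul_whiskerRight, Linear.comp_smul, Linear.smul_comp,
      lastSwap_braid]

/-- The partial trace sends `a ▷ V` to `d • a`, and the term with the transposition to
`a ≫ a = a`. -/
theorem IsSymmetrizerPair.partialTrace_right (h : IsSymmetrizerPair e n a b) (V' : C)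
    [ExactPairing V V'] {d : ℂ} (hd : trace V' (𝟙 V) = d • 𝟙 (𝟙_ C)) :
    partialTrace V' b = ((d + e * ((n : ℂ) + 1)) / ((n : ℂ) + 1 + 1)) • a := by
  have h1 : partialTrace V' (a ▷ V) = d • a := by
    have := partialTrace_whiskerRight V' a (𝟙 _) (𝟙 ((T ⊗ V) ⊗ V))
    rw [partialTrace_id_eq_smul V' hd] at this
    simpa using this
  have h2 : partialTrace V' (a ▷ V ≫ lastSwap T V ≫ a ▷ V) = a := by
    rw [partialTrace_whiskerRight, partialTrace_lastSwap, Category.id_comp, h.left_idem]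
  have hn := natCast_add_two_ne_zero n
  have hn' : (n : ℂ) + 1 + 1 = n + 2 := by ring
  apply smul_right_injective _ hn
  change ((n : ℂ) + 2) • partialTrace V' b = ((n : ℂ) + 2) • _
  rw [← partialTrace_smul, h.smul_right, partialTrace_add, Linear.smul_comp, Linear.comp_smul,
    partialTrace_smul, partialTrace_smul, h1, h2, smul_smul, smul_smul, hn', mul_div_cancel₀ _ hn,
    ← add_smul, mul_comm e]

/-- For `e = 1` and `e = -1` the idempotents are the symmetrizer and the antisymmetrizer of
`V^{⊗n}`. -/
theorem exists_idempotent_trace_eq_prod [RigidCategory C] (he : e * e = 1) (V : C) {d : ℂ}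
    (hd : trace Vᘁ (𝟙 V) = d • 𝟙 (𝟙_ C)) (n : ℕ) :
    ∃ (X : C) (p : X ⟶ X), p ≫ p = p ∧
      trace Xᘁ p = (∏ j ∈ Finset.range n, (d + e * (j : ℂ)) / ((j : ℂ) + 1)) • 𝟙 (𝟙_ C) := by
  have hpair : ∀ n : ℕ, ∃ (T : C) (a : T ⊗ V ⟶ T ⊗ V) (b : (T ⊗ V) ⊗ V ⟶ (T ⊗ V) ⊗ V),
      IsSymmetrizerPair e n a b ∧ trace (T ⊗ V)ᘁ a =
        (∏ j ∈ Finset.range (n + 1), (d + e * (j : ℂ)) / ((j : ℂ) + 1)) • 𝟙 (𝟙_ C) := by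
    intro n
    induction n with
    | zero =>
      obtain ⟨b, hb⟩ := exists_isSymmetrizerPair_zero he (𝟙_ C) V
      refine ⟨_, _, b, hb, ?_⟩
      rw [trace_eq_trace _ (Vᘁ ⊗ 𝟙_ C), trace_tensor, partialTrace_id_eq_smul Vᘁ hd, trace_smul,
        trace_unit]
      simp
    | succ n ih =>
      obtain ⟨T, a, b, hab, ha⟩ := ih
      obtain ⟨c, hc⟩ := hab.exists_succ he
      refine ⟨_, b, c, hc, ?_⟩
      rw [trace_eq_trace _ (Vᘁ ⊗ (T ⊗ V)ᘁ), trace_tensor, hab.partialTrace_right Vᘁ hd,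
        trace_smul, ha, smul_smul, Finset.prod_range_succ _ (n + 1), mul_comm]
      push_cast
      rfl
  cases n with
  | zero =>
    refine ⟨𝟙_ C, 𝟙 _, Category.comp_id _, ?_⟩
    rw [trace_eq_trace _ (𝟙_ C), trace_unit]
    simp
  | succ n =>
    obtain ⟨T, a, b, hab, ha⟩ := hpair n
    exact ⟨_, a, hab.left_idem, ha⟩

end Symmetrizer

/-! ### Integrality of the dimensions -/

section Integrality
variable {C : Type u} [Category.{v} C] [Preadditive C] [Linear ℂ C] [MonoidalCategory C]
  [SymmetricCategory C] [RigidCategory C] (hEnd : EndUnitIsComplex C)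

theorem trace_id_eq_smul (V : C) : trace Vᘁ (𝟙 V) = categoricalDim hEnd V • 𝟙 (𝟙_ C) := by
  rw [categoricalDim_smul_id, ← dimHom_eq_trace]
  rfl

theorem categoricalDim_eq_of_trace_id {V : C} {c : ℂ} (h : trace Vᘁ (𝟙 V) = c • 𝟙 (𝟙_ C)) :
    categoricalDim hEnd V = c := by
  apply hEnd.injective
  change categoricalDim hEnd V • 𝟙 (𝟙_ C) = c • 𝟙 (𝟙_ C)
  rw [← trace_id_eq_smul, h]

theorem categoricalDim_unit : categoricalDim hEnd (𝟙_ C) = 1 := by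
  apply categoricalDim_eq_of_trace_id
  rw [trace_eq_trace _ (𝟙_ C), trace_unit, one_smul]

variable [MonoidalPreadditive C] [MonoidalLinear ℂ C]

theorem categoricalDim_tensor (V W : C) :
    categoricalDim hEnd (V ⊗ W) = categoricalDim hEnd V * categoricalDim hEnd W := by
  apply categoricalDim_eq_of_trace_id
  rw [trace_eq_trace _ (Wᘁ ⊗ Vᘁ), trace_tensor,
    partialTrace_id_eq_smul Wᘁ (trace_id_eq_smul hEnd W), trace_smul,
    trace_id_eq_smul hEnd V, smul_smul, mul_comm]

/-- The object is the symmetric power of `V` for `e = 1` and the exterior power for `e = -1`, as the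
image of an idempotent of `V^{⊗n}`. -/
theorem exists_categoricalDim_eq_prod [IsIdempotentComplete C] {e : ℂ} (he : e * e = 1) (V : C)
    (n : ℕ) :
    ∃ X : C, categoricalDim hEnd X =
      ∏ j ∈ Finset.range n, (categoricalDim hEnd V + e * (j : ℂ)) / ((j : ℂ) + 1) := by
  obtain ⟨X, p, hp, htr⟩ := exists_idempotent_trace_eq_prod he V (trace_id_eq_smul hEnd V) n
  obtain ⟨Y, i, r, hir, hri⟩ := IsIdempotentComplete.idempotents_split X p hp
  refine ⟨Y, categoricalDim_eq_of_trace_id hEnd ?_⟩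
  rw [← hir, trace_comp_comm, hri, htr]

end Integrality

section FinitelyManySimples
variable {C : Type u} [Category.{v} C] [Abelian C] [Linear ℂ C] [MonoidalCategory C]
  [SymmetricCategory C] [RigidCategory C] [MonoidalPreadditive C] [MonoidalLinear ℂ C]
  (hEnd : EndUnitIsComplex C)

/-- The dimensions span a finitely generated `ℤ`-submodule of `ℂ`, which is stable under
multiplication by each of them. -/
theorem isIntegral_categoricalDim (hLength : FiniteLength C) (hSimples : FinitelyManySimples C)
    (V : C) : IsIntegral ℤ (categoricalDim hEnd V) := by
  obtain ⟨m, S, -, hS⟩ := hSimples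
  let M : Submodule ℤ ℂ := Submodule.span ℤ (Set.range fun i => categoricalDim hEnd (S i))
  have hM : ∀ X : C, categoricalDim hEnd X ∈ M := by
    refine fun X => dimHom_mem_of_simple (M.toAddSubgroup.comap
      ((RingEquiv.ofBijective (algebraMap ℂ (End (𝟙_ C))) hEnd).symm : End (𝟙_ C) →+ ℂ))
      hLength (fun Y hY => ?_) X
    obtain ⟨i, ⟨f⟩⟩ := hS Y hY
    rw [dimHom_eq_of_iso f]
    exact Submodule.subset_span ⟨i, rfl⟩
  refine isIntegral_of_smul_mem_submodule M ?_ (Submodule.fg_span (Set.finite_range _)) _ ?_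
  · intro h0
    have h1 := hM (𝟙_ C)
    rw [categoricalDim_unit, h0, Submodule.mem_bot] at h1
    exact one_ne_zero h1
  · intro x hx
    induction hx using Submodule.span_induction with
    | mem x hx =>
      obtain ⟨i, rfl⟩ := hx
      rw [smul_eq_mul, ← categoricalDim_tensor]
      exact hM _
    | zero => rw [smul_zero]; exact M.zero_mem
    | add x y _ _ hx hy => rw [smul_add]; exact M.add_mem hx hy
    | smul r x _ hx => rw [smul_comm]; exact M.smul_mem r hx

end FinitelyManySimples

end SymCat

theorem theorem7p2 (C : Type u) [Category.{v} C] [Abelian C] [Linear ℂ C]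
    [MonoidalCategory C] [MonoidalPreadditive C] [MonoidalLinear ℂ C]
    [SymmetricCategory C] [RigidCategory C]
    (hEnd : SymCat.EndUnitIsComplex C)
    (hLength : SymCat.FiniteLength C)
    (hSimples : SymCat.FinitelyManySimples C) (V : C) :
    ∃ n : ℤ, SymCat.categoricalDim hEnd V = (n : ℂ) := by
  have hint := SymCat.isIntegral_categoricalDim hEnd hLength hSimples
  refine SymCat.exists_int_of_isIntegral_prod _ (hint V) fun n => ?_
  obtain ⟨X, hX⟩ := SymCat.exists_categoricalDim_eq_prod hEnd (e := 1) (by norm_num) V n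
  obtain ⟨Y, hY⟩ := SymCat.exists_categoricalDim_eq_prod hEnd (e := -1) (by norm_num) V n
  have h := (hint X).mul (hint Y)
  rw [hX, hY, ← Finset.prod_mul_distrib] at h
  convert! h using 1
  refine Finset.prod_congr rfl fun j _ => ?_
  rw [div_mul_div_comm]
  congr 1 <;> ring
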